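/- Let $\mathcal G=(V,E)$ be a finite connected (simple, undirected) graph with $n$ nodes and $m$ edges, with oriented incidence matrix $B\in\mathbb R^{n\times m}$ (for an arbitrary orientation of the edges), let $r\in\mathbb N$ and put $\mathbb B=B\otimes I_r$. For every node $i$ let $M_i,R_i\in\mathbb R^{r\times r}$ be symmetric with $M_i\succ0$ and $R_i\succcurlyeq0$, and for every edge $k$ let $W_k\in\mathbb R^{r\times r}$ be symmetric with $W_k\succ 0$; put $M=\mathrm{diag}(M_1,\dots,M_n)$, $R=\mathrm{diag}(R_1,\dots,R_n)$, $W=\mathrm{diag}(W_1,\dots,W_m)$. Call node $i$ damped if $R_i\succ0$ and (partially) undamped if $R_i$ is singular, and assume that there is at least one node of each kind. Write $p_d,p_u$ for the subvectors of $p\in\mathbb R^{rn}$ belonging to the damped and the (partially) undamped nodes, and $M_u,R_u$ for the corresponding diagonal blocks of $M,R$. Consider the shifted system $$\dot{\tilde p}=-RM^{-1}\tilde p-\mathbb BW\tilde q,\qquad \dot{\tilde q}=\mathbb B^TM^{-1}\tilde p,\qquad t\ge0,$$ with state $\tilde z=\mathrm{col}(\tilde p,\tilde q)\in\mathbb R^{r(n+m)}$,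 on the invariant subspace $\Omega=\{\mathrm{col}(\tilde p,\tilde q)\mid\tilde q\in\mathrm{im}(\mathbb B^T)\}$. Let $\mathcal S^{LS}$ be the set of all initial conditions $\tilde z(0)\in\Omega$ whose solution $\tilde z(t)=\mathrm{col}(\tilde p(t),\tilde q(t))$ satisfies $\tilde p_d(t)=0$ and $\tilde p_u(t)\in\ker(R_uM_u^{-1})$ for all $t\ge0$. Say that $\tilde z(t)$ converges to a set $T\subseteq\mathbb R^{r(n+m)}$ if the distance from $\tilde z(t)$ to $T$ tends to $0$ as $t\to\infty$ (nothing converges to the empty set). Then $\mathcal S^{LS}$ is the smallest closed set to which all solutions of the shifted system in $\Omega$ converge: $\mathcal S^{LS}$ is closed, every solution in $\Omega$ converges to $\mathcal S^{LS}$, and every closed set $T\subseteq\mathbb R^{r(n+m)}$ to which all solutions in $\Omega$ converge contains $\mathcal S^{LS}$. -/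

import Mathlib

open scoped Matrix Kronecker

/-- A block diagonal matrix `diag(N_1, …, N_k)` with `r × r` blocks, indexed compatibly with the
Kronecker product `B ⊗ I_r`: the pair `(i, a)` is coordinate `a` of block `i`. -/
def stackDiag {ι : Type*} [DecidableEq ι] {r : ℕ} (N : ι → Matrix (Fin r) (Fin r) ℝ) :
    Matrix (ι × Fin r) (ι × Fin r) ℝ :=
  (Matrix.blockDiagonal N).submatrix Prod.swap Prod.swap

/-- The data of a linear mass-spring-damper network on the graph `G`, with `r`-dimensional node and
edge dynamics: an (arbitrary) orientation of the edges, inertia matrices `M i ≻ 0`, damping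
matrices `R i ≽ 0` and edge weight matrices `W e ≻ 0` (all symmetric, which is part of
`Matrix.PosDef` and `Matrix.PosSemidef`). -/
structure Network {V : Type*} (G : SimpleGraph V) (r : ℕ) where
  tail : G.edgeSet → V
  head : G.edgeSet → V
  ends : ∀ e : G.edgeSet, s(tail e, head e) = (e : Sym2 V)
  M : V → Matrix (Fin r) (Fin r) ℝ
  R : V → Matrix (Fin r) (Fin r) ℝ
  W : G.edgeSet → Matrix (Fin r) (Fin r) ℝ
  M_posDef : ∀ i, (M i).PosDef
  R_posSemidef : ∀ i, (R i).PosSemidef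
  W_posDef : ∀ e, (W e).PosDef

namespace Network

/-- Stacked states `col(p, q)`, with `p` indexed by `V × Fin r` and `q` by `E × Fin r`. The space
carries the sup norm, which on this finite-dimensional space is equivalent to the Euclidean one. -/
abbrev State {V : Type*} {G : SimpleGraph V} {r : ℕ} (_N : Network G r) : Type _ :=
  (V × Fin r) ⊕ (G.edgeSet × Fin r) → ℝ

/-- A node is damped if its damping matrix is positive definite. -/
def IsDamped {V : Type*} {G : SimpleGraph V} {r : ℕ} (N : Network G r) (i : V) : Prop :=
  (N.R i).PosDef

/-- A node is (partially) undamped if its damping matrix is singular. -/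
def IsUndamped {V : Type*} {G : SimpleGraph V} {r : ℕ} (N : Network G r) (i : V) : Prop :=
  (N.R i).det = 0

/-- The (oriented) incidence matrix `B` of the graph. -/
def inc {V : Type*} [DecidableEq V] {G : SimpleGraph V} {r : ℕ} (N : Network G r) :
    Matrix V G.edgeSet ℝ :=
  Matrix.of fun i e => if i = N.head e then 1 else if i = N.tail e then -1 else 0

/-- `𝔹 = B ⊗ I_r`. -/
def bigB {V : Type*} [DecidableEq V] {G : SimpleGraph V} {r : ℕ} (N : Network G r) :
    Matrix (V × Fin r) (G.edgeSet × Fin r) ℝ :=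
  N.inc ⊗ₖ (1 : Matrix (Fin r) (Fin r) ℝ)

/-- The system matrix of the shifted closed-loop system
`ṗ = -R M⁻¹ p - 𝔹 W q`, `q̇ = 𝔹ᵀ M⁻¹ p`. -/
noncomputable def sysMatrix {V : Type*} [Fintype V] [DecidableEq V] {G : SimpleGraph V}
    [Fintype G.edgeSet] {r : ℕ} (N : Network G r) :
    Matrix ((V × Fin r) ⊕ (G.edgeSet × Fin r)) ((V × Fin r) ⊕ (G.edgeSet × Fin r)) ℝ :=
  Matrix.fromBlocks
    (-(stackDiag N.R * (stackDiag N.M)⁻¹)) (-(N.bigB * stackDiag N.W))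
    (N.bigBᵀ * (stackDiag N.M)⁻¹) 0

/-- `z` is a solution, on `[0, ∞)`, of the shifted system `ż = A z`. -/
def IsSolution {V : Type*} [Fintype V] [DecidableEq V] {G : SimpleGraph V}
    [Fintype G.edgeSet] {r : ℕ} (N : Network G r) (z : ℝ → N.State) : Prop :=
  ∀ t : ℝ, 0 ≤ t → HasDerivWithinAt z (N.sysMatrix *ᵥ z t) (Set.Ici 0) t

/-- `Ω = {col(p, q) | q ∈ im 𝔹ᵀ}`. -/
def Omega {V : Type*} [Fintype V] [DecidableEq V] {G : SimpleGraph V} {r : ℕ}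
    (N : Network G r) : Set N.State :=
  {x | ∃ s : V × Fin r → ℝ, ∀ k, x (Sum.inr k) = (N.bigBᵀ *ᵥ s) k}

/-- The LaSalle set: all initial conditions in `Ω` of solutions such that for all `t ≥ 0`,
`p_d(t) = 0` and `p_u(t) ∈ ker (R_u M_u⁻¹)`. Since `R_u` and `M_u` are block diagonal, the latter
says `R_i M_i⁻¹ p_i(t) = 0` for each (partially) undamped node `i`. -/
def laSalleSet {V : Type*} [Fintype V] [DecidableEq V] {G : SimpleGraph V}
    [Fintype G.edgeSet] {r : ℕ} (N : Network G r) : Set N.State :=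
  {x | x ∈ N.Omega ∧ ∃ z : ℝ → N.State, N.IsSolution z ∧ z 0 = x ∧ ∀ t : ℝ, 0 ≤ t →
    (∀ i, N.IsDamped i → ∀ a, z t (Sum.inl (i, a)) = 0) ∧
    (∀ i, N.IsUndamped i → (N.R i * (N.M i)⁻¹) *ᵥ (fun a => z t (Sum.inl (i, a))) = 0)}

end Network

/-- `z(t)` converges to the set `T` as `t → ∞`: the distance from `z(t)` to `T` tends to `0`
(no function converges to the empty set). -/
def ConvergesToSet {X : Type*} [PseudoMetricSpace X] (z : ℝ → X) (T : Set X) : Prop :=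
  ∀ ε : ℝ, 0 < ε → ∀ᶠ t in Filter.atTop, ∃ y ∈ T, dist (z t) y < ε

/-! The energy pᵀM⁻¹p + qᵀWq is a positive definite quadratic form whose derivative along solutions
is -2(M⁻¹p)ᵀR(M⁻¹p). Orbits are therefore bounded, and dissipation stops exactly where RM⁻¹p = 0,
which is the pair of conditions defining the LaSalle set (`dampingForce_eq_zero_iff`). Attraction is
LaSalle's argument: along the orbit of a limit point the energy cannot drop
(`IsEnergy.convergesToSet`). Minimality rests on recurrence (`IsEnergy.frequently_dist_flow_lt`).
Where the damping force vanishes along the whole orbit, the flow preserves the energy norm. A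
bounded orbit comes close to itself at two late times, and pulling back by this isometry shows that
it returns close to its starting point. A closed set attracting that orbit must contain this point.
-/

open Filter Topology Set

/-! ### Linear flows with a quadratic energy -/

section LaSalle

variable {X : Type*} [NormedAddCommGroup X] [NormedSpace ℝ X]

/-- The flow `t ↦ exp (t L)` of the linear differential equation `ż = L z`. -/
noncomputable def linearFlow (L : X →L[ℝ] X) (t : ℝ) : X →L[ℝ] X := NormedSpace.exp (t • L)

lemma linearFlow_zero (L : X →L[ℝ] X) (x : X) : linearFlow L 0 x = x := by
  simp [linearFlow]

lemma linearFlow_add [CompleteSpace X] (L : X →L[ℝ] X) (s t : ℝ) (x : X) :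
    linearFlow L (s + t) x = linearFlow L s (linearFlow L t x) := by
  have h : Commute (s • L) (t • L) := ((Commute.refl L).smul_left s).smul_right t
  let : NormedAlgebra ℚ (X →L[ℝ] X) := NormedAlgebra.restrictScalars ℚ ℝ _
  simp only [linearFlow]
  rw [add_smul, NormedSpace.exp_add_of_commute h]
  rfl

lemma hasDerivAt_linearFlow_apply [CompleteSpace X] (L : X →L[ℝ] X) (x : X) (t : ℝ) :
    HasDerivAt (fun s => linearFlow L s x) (L (linearFlow L t x)) t := by
  have h := (hasDerivAt_exp_smul_const' (𝕂 := ℝ) L t).clm_apply (hasDerivAt_const t x)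
  simpa [linearFlow] using h

/-- A subspace containing the range of `L` is invariant under the flow of `L`. -/
lemma linearFlow_apply_mem [FiniteDimensional ℝ X] [CompleteSpace X] {L : X →L[ℝ] X}
    {U : Submodule ℝ X} (hU : ∀ x, L x ∈ U) {x : X} (hx : x ∈ U) (t : ℝ) :
    linearFlow L t x ∈ U := by
  by_contra hnot
  obtain ⟨f, hf, hker⟩ := Submodule.exists_le_ker_of_notMem hnot
  have hd : ∀ s, HasDerivAt (fun s => f.toContinuousLinearMap (linearFlow L s x)) 0 s := fun s => by
    have h := f.toContinuousLinearMap.hasFDerivAt.comp_hasDerivAt s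
      (hasDerivAt_linearFlow_apply L x s)
    exact h.congr_deriv (hker (hU _))
  have hc := is_const_of_deriv_eq_zero (fun s => (hd s).differentiableAt) (fun s => (hd s).deriv) t 0
  simp only [linearFlow_zero] at hc
  exact hf (hc.trans (hker hx))

lemma HasDerivWithinAt.bilin_self {B : X →L[ℝ] X →L[ℝ] ℝ}
    (hsymm : ∀ x y, B x y = B y x) {z : ℝ → X} {z' : X} {s : Set ℝ} {t : ℝ}
    (hz : HasDerivWithinAt z z' s t) :
    HasDerivWithinAt (fun u => B (z u) (z u)) (2 * B (z t) z') s t := by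
  have h := (B.hasFDerivAt.comp_hasDerivWithinAt t hz).clm_apply hz
  refine h.congr_deriv ?_
  simp [hsymm z' (z t), two_mul]

/-- `B` is an energy for the equation `ż = L z`: a positive definite symmetric form that does not
increase along solutions, and whose dissipation vanishes exactly where the linear map `K` does. -/
structure IsEnergy {Y : Type*} [AddCommGroup Y] [Module ℝ Y] (L : X →L[ℝ] X)
    (B : X →L[ℝ] X →L[ℝ] ℝ) (K : X →ₗ[ℝ] Y) : Prop where
  symm : ∀ x y, B x y = B y x
  pos : ∀ x, x ≠ 0 → 0 < B x x
  nonpos : ∀ x, B x (L x) ≤ 0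
  eq_zero_iff : ∀ x, B x (L x) = 0 ↔ K x = 0

/-- The points of `U` along whose forward orbit `K` vanishes. -/
def unobservableSet {Y : Type*} [AddCommGroup Y] [Module ℝ Y] (L : X →L[ℝ] X)
    (K : X →ₗ[ℝ] Y) (U : Submodule ℝ X) : Set X :=
  {x | x ∈ U ∧ ∀ t, 0 ≤ t → K (linearFlow L t x) = 0}

namespace IsEnergy

variable {Y : Type*} [AddCommGroup Y] [Module ℝ Y] {L : X →L[ℝ] X}
    {B : X →L[ℝ] X →L[ℝ] ℝ} {K : X →ₗ[ℝ] Y}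

lemma nonneg (h : IsEnergy L B K) (x : X) : 0 ≤ B x x := by
  rcases eq_or_ne x 0 with rfl | hx
  · simp
  · exact (h.pos x hx).le

/-- Take for `c` the minimum of the energy on the compact unit sphere and scale. -/
lemma exists_mul_sq_norm_le [FiniteDimensional ℝ X] (h : IsEnergy L B K) :
    ∃ c : ℝ, 0 < c ∧ ∀ x, c * ‖x‖ ^ 2 ≤ B x x := by
  have : ProperSpace X := FiniteDimensional.proper ℝ X
  rcases subsingleton_or_nontrivial X with hX | hX
  · exact ⟨1, one_pos, fun x => by simp [Subsingleton.elim x 0]⟩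
  obtain ⟨v, hv, hmin⟩ := (isCompact_sphere (0 : X) 1).exists_isMinOn
    (NormedSpace.sphere_nonempty.2 zero_le_one)
    (f := fun x => B x x) (by fun_prop)
  refine ⟨B v v, h.pos v (ne_zero_of_mem_unit_sphere ⟨v, hv⟩), fun x => ?_⟩
  rcases eq_or_ne x 0 with rfl | hx
  · simp
  have hn : ‖x‖ ≠ 0 := norm_ne_zero_iff.2 hx
  have hm : B v v ≤ B (‖x‖⁻¹ • x) (‖x‖⁻¹ • x) := hmin (by simp [norm_smul, hn])
  simp only [map_smul, smul_apply, smul_eq_mul] at hm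
  calc B v v * ‖x‖ ^ 2 ≤ (‖x‖⁻¹ * (‖x‖⁻¹ * B x x)) * ‖x‖ ^ 2 := by gcongr
    _ = B x x := by field_simp

lemma antitoneOn (h : IsEnergy L B K) {z : ℝ → X}
    (hz : ∀ t, 0 ≤ t → HasDerivWithinAt z (L (z t)) (Ici 0) t) :
    AntitoneOn (fun t => B (z t) (z t)) (Ici 0) := by
  have hd := fun t ht => (hz t ht).bilin_self h.symm
  refine antitoneOn_of_hasDerivWithinAt_nonpos (convex_Ici 0)
    (fun t ht => (hd t ht).continuousWithinAt)
    (fun t ht => (hd t (interior_subset ht)).mono interior_subset) fun t _ => ?_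
  linarith [h.nonpos (z t)]

/-- Solutions are determined by their initial values. -/
lemma eq_linearFlow [CompleteSpace X] (h : IsEnergy L B K) {z : ℝ → X}
    (hz : ∀ t, 0 ≤ t → HasDerivWithinAt z (L (z t)) (Ici 0) t) {t : ℝ} (ht : 0 ≤ t) :
    z t = linearFlow L t (z 0) := by
  -- By linearity the difference from the flow is a solution starting at 0; its energy starts at 0
  -- and cannot grow.
  have hw : ∀ t, 0 ≤ t → HasDerivWithinAt (fun t => z t - linearFlow L t (z 0))
      (L (z t - linearFlow L t (z 0))) (Ici 0) t := fun t ht => by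
    rw [map_sub]
    exact (hz t ht).sub (hasDerivAt_linearFlow_apply L (z 0) t).hasDerivWithinAt
  have hle := h.antitoneOn hw (mem_Ici.2 le_rfl) (mem_Ici.2 ht) ht
  simp only [linearFlow_zero, sub_self, map_zero] at hle
  by_contra hne
  exact (h.pos _ (sub_ne_zero.2 hne)).not_ge hle

lemma hasDerivAt_flow [CompleteSpace X] (h : IsEnergy L B K) (x : X) (t : ℝ) :
    HasDerivAt (fun t => B (linearFlow L t x) (linearFlow L t x))
      (2 * B (linearFlow L t x) (L (linearFlow L t x))) t :=
  hasDerivWithinAt_univ.1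
    ((hasDerivAt_linearFlow_apply L x t).hasDerivWithinAt.bilin_self h.symm)

lemma flow_antitoneOn [CompleteSpace X] (h : IsEnergy L B K) (x : X) :
    AntitoneOn (fun t => B (linearFlow L t x) (linearFlow L t x)) (Ici 0) :=
  h.antitoneOn fun t _ => (hasDerivAt_linearFlow_apply L x t).hasDerivWithinAt

/-- The energy is conserved along orbits on which `K` vanishes. -/
lemma flow_eq_of_forall [CompleteSpace X] (h : IsEnergy L B K) {x : X}
    (hx : ∀ t, 0 ≤ t → K (linearFlow L t x) = 0) {t : ℝ} (ht : 0 ≤ t) :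
    B (linearFlow L t x) (linearFlow L t x) = B x x := by
  have := constant_of_has_deriv_right_zero (a := 0) (b := t)
    (fun s _ => (h.hasDerivAt_flow x s).continuousAt.continuousWithinAt)
    (fun s hs => ((h.hasDerivAt_flow x s).hasDerivWithinAt (s := Ici s)).congr_deriv
      (by rw [(h.eq_zero_iff _).2 (hx s hs.1), mul_zero])) t ⟨ht, le_rfl⟩
  simpa only [linearFlow_zero] using this

/-- `K` vanishes along an orbit on which the energy does not drop. -/
lemma forall_of_le_flow [CompleteSpace X] (h : IsEnergy L B K) {x : X}
    (hx : ∀ t, 0 ≤ t → B x x ≤ B (linearFlow L t x) (linearFlow L t x)) {t : ℝ} (ht : 0 ≤ t) :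
    K (linearFlow L t x) = 0 := by
  have hconst : ∀ s ∈ Ici (0 : ℝ), B (linearFlow L s x) (linearFlow L s x) = B x x := fun s hs => by
    refine le_antisymm ?_ (hx s hs)
    simpa only [linearFlow_zero] using h.flow_antitoneOn x (mem_Ici.2 le_rfl) hs hs
  have h1 : HasDerivWithinAt (fun s => B (linearFlow L s x) (linearFlow L s x)) 0 (Ici 0) t :=
    (hasDerivWithinAt_const t (Ici 0) (B x x)).congr hconst (hconst t ht)
  -- One-sided derivatives within `Ici 0` are unique, so the dissipation vanishes, at time 0
  -- included.
  have h2 := (uniqueDiffOn_Ici (0 : ℝ) t ht).eq_deriv _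
    (h.hasDerivAt_flow x t).hasDerivWithinAt h1
  exact (h.eq_zero_iff _).1 (by linarith)

lemma isClosed_unobservableSet [FiniteDimensional ℝ X] (h : IsEnergy L B K)
    (U : Submodule ℝ X) : IsClosed (unobservableSet L K U) := by
  -- `Y` carries no topology, so the kernel of `K` is replaced by the zero set of the continuous
  -- dissipation.
  have : unobservableSet L K U = (U : Set X) ∩ ⋂ t : ℝ, ⋂ _ : 0 ≤ t,
      {x | B (linearFlow L t x) (L (linearFlow L t x)) = 0} := by
    ext x
    simp [unobservableSet, h.eq_zero_iff]
  rw [this]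
  refine U.closed_of_finiteDimensional.inter (isClosed_iInter fun t => isClosed_iInter fun _ => ?_)
  exact isClosed_eq (by fun_prop) continuous_const

lemma exists_norm_flow_le [FiniteDimensional ℝ X] [CompleteSpace X] (h : IsEnergy L B K) (x : X) :
    ∃ b : ℝ, ∀ t, 0 ≤ t → ‖linearFlow L t x‖ ≤ b := by
  obtain ⟨c, hc, hcB⟩ := h.exists_mul_sq_norm_le
  refine ⟨√(B x x / c), fun t ht => Real.le_sqrt_of_sq_le ?_⟩
  have hle := h.flow_antitoneOn x (mem_Ici.2 le_rfl) (mem_Ici.2 ht) ht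
  simp only [linearFlow_zero] at hle
  rw [le_div_iff₀ hc]
  linarith [hcB (linearFlow L t x)]

/-- LaSalle's invariance principle for linear dissipative systems. -/
lemma convergesToSet [FiniteDimensional ℝ X] [CompleteSpace X] (h : IsEnergy L B K)
    {U : Submodule ℝ X} (hU : ∀ x, L x ∈ U) {x : X} (hx : x ∈ U) :
    ConvergesToSet (fun t => linearFlow L t x) (unobservableSet L K U) := by
  have : ProperSpace X := FiniteDimensional.proper ℝ X
  intro ε hε
  by_contra hnot
  obtain ⟨b, hb⟩ := h.exists_norm_flow_le x
  have hfreq : ∀ n : ℕ, ∃ t : ℝ, (n : ℝ) ≤ t ∧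
      ∀ y ∈ unobservableSet L K U, ε ≤ dist (linearFlow L t x) y := fun n => by
    obtain ⟨t, ht, hy⟩ := frequently_atTop.1 (not_eventually.1 hnot) n
    push Not at hy
    exact ⟨t, ht, hy⟩
  choose t htn hty using hfreq
  have ht0 : ∀ n, 0 ≤ t n := fun n => n.cast_nonneg.trans (htn n)
  obtain ⟨y, -, φ, hφ, hlim⟩ := tendsto_subseq_of_bounded (Metric.isBounded_closedBall (x := (0 : X))
    (r := b)) (x := fun n => linearFlow L (t n) x) fun n => by simpa using hb _ (ht0 n)
  have ht : Tendsto (t ∘ φ) atTop atTop :=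
    (tendsto_atTop_mono htn tendsto_natCast_atTop_atTop).comp hφ.tendsto_atTop
  have hBlim : ∀ s : ℝ, Tendsto (fun n => B (linearFlow L (s + t (φ n)) x)
      (linearFlow L (s + t (φ n)) x)) atTop (𝓝 (B (linearFlow L s y) (linearFlow L s y))) :=
    fun s => by
    simp only [linearFlow_add L s]
    have hcont : Continuous fun w => B (linearFlow L s w) (linearFlow L s w) := by fun_prop
    exact (hcont.tendsto y).comp hlim
  -- The energy decreases along the orbit of `x`, so its limit `B y y` along the times `t (φ n)` is
  -- a lower bound at every time.
  have hge : ∀ s, 0 ≤ s → B y y ≤ B (linearFlow L s x) (linearFlow L s x) := fun s hs => by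
    have h0 := hBlim 0
    simp only [linearFlow_zero, zero_add] at h0
    refine le_of_tendsto h0 ?_
    filter_upwards [ht.eventually_ge_atTop s] with n hn
    exact h.flow_antitoneOn x (mem_Ici.2 hs) (mem_Ici.2 (ht0 _)) hn
  have hy : y ∈ unobservableSet L K U := by
    refine ⟨U.closed_of_finiteDimensional.mem_of_tendsto hlim
      (Eventually.of_forall fun n => linearFlow_apply_mem hU hx _), fun s hs => ?_⟩
    -- The energy of `y` at time `s` is a limit of energies of `x` at times `s + t (φ n)`, all at
    -- least `B y y`.
    exact h.forall_of_le_flow (fun s hs => ge_of_tendsto' (hBlim s) fun n =>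
      hge _ (add_nonneg hs (ht0 _))) hs
  have hd : Tendsto (fun n => dist (linearFlow L (t (φ n)) x) y) atTop (𝓝 0) :=
    tendsto_iff_dist_tendsto_zero.1 hlim
  exact hε.not_ge (ge_of_tendsto' hd fun n => hty _ y hy)

/-- Points along whose orbit `K` vanishes are recurrent. -/
lemma frequently_dist_flow_lt [FiniteDimensional ℝ X] [CompleteSpace X] (h : IsEnergy L B K)
    {x : X} (hx : ∀ t, 0 ≤ t → K (linearFlow L t x) = 0) {ε : ℝ} (hε : 0 < ε) :
    ∃ᶠ t in atTop, dist (linearFlow L t x) x < ε := by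
  have : ProperSpace X := FiniteDimensional.proper ℝ X
  obtain ⟨c, hc, hcB⟩ := h.exists_mul_sq_norm_le
  obtain ⟨b, hb⟩ := h.exists_norm_flow_le x
  obtain ⟨y, -, φ, hφ, hlim⟩ := tendsto_subseq_of_bounded (Metric.isBounded_closedBall (x := (0 : X))
    (r := b)) (x := fun n : ℕ => linearFlow L n x) fun n => by simpa using hb _ n.cast_nonneg
  have hcont : Continuous fun w => B w w := by fun_prop
  -- Energy below `c * ε ^ 2` forces norm below `ε`.
  have hsmall : ∀ᶠ w in 𝓝 0, B w w < c * ε ^ 2 :=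
    (hcont.tendsto 0).eventually_lt_const (by simpa using by positivity)
  obtain ⟨δ, hδ, hBδ⟩ := Metric.eventually_nhds_iff.1 hsmall
  obtain ⟨m, hm⟩ := Metric.cauchySeq_iff'.1 hlim.cauchySeq δ hδ
  rw [frequently_atTop]
  intro a
  -- This choice makes the return time `φ k - φ m` at least `a`.
  obtain ⟨n, hn⟩ := exists_nat_ge (a + φ m)
  set k := max n m
  have hk : (n : ℝ) ≤ φ k := by exact_mod_cast (le_max_left n m).trans (hφ.id_le k)
  have hmk : (φ m : ℝ) ≤ φ k := by exact_mod_cast hφ.monotone (le_max_right n m)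
  refine ⟨φ k - φ m, by linarith, ?_⟩
  have hs : (0 : ℝ) ≤ φ k - φ m := by linarith
  -- The displacement is a difference of two points of the orbit, so `K` vanishes along its orbit
  -- too and its energy is conserved. Flowing it for time `φ m` gives the small difference between
  -- times `φ k` and `φ m`.
  have hKw : ∀ s, 0 ≤ s → K (linearFlow L s (linearFlow L (φ k - φ m) x - x)) = 0 := fun s h0 => by
    rw [map_sub, ← linearFlow_add, map_sub, hx _ (add_nonneg h0 hs), hx s h0, sub_zero]
  have hE := h.flow_eq_of_forall hKw (t := φ m) (Nat.cast_nonneg _)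
  rw [map_sub, ← linearFlow_add, add_sub_cancel] at hE
  have hlt := hBδ (y := linearFlow L (φ k) x - linearFlow L (φ m) x)
    (by simpa [dist_eq_norm] using hm k (le_max_right n m))
  have h1 := hcB (linearFlow L (φ k - φ m) x - x)
  rw [dist_eq_norm]
  have h2 : c * ‖linearFlow L (φ k - φ m) x - x‖ ^ 2 < c * ε ^ 2 := by linarith
  exact lt_of_pow_lt_pow_left₀ 2 hε.le (lt_of_mul_lt_mul_left h2 hc.le)

/-- At arbitrarily late times the orbit of `x` is near `x` by recurrence, and by then it is also
near `T`. -/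
lemma unobservableSet_subset [FiniteDimensional ℝ X] [CompleteSpace X] (h : IsEnergy L B K)
    {U : Submodule ℝ X} {T : Set X} (hT : IsClosed T)
    (hconv : ∀ x ∈ U, ConvergesToSet (fun t => linearFlow L t x) T) :
    unobservableSet L K U ⊆ T := by
  intro x hx
  rw [← hT.closure_eq, Metric.mem_closure_iff]
  intro ε hε
  obtain ⟨t, h1, y, hy, h2⟩ := ((h.frequently_dist_flow_lt hx.2 (half_pos hε)).and_eventually
    (hconv x hx.1 _ (half_pos hε))).exists
  refine ⟨y, hy, ?_⟩
  linarith [dist_triangle_left x y (linearFlow L t x)]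

end IsEnergy

end LaSalle

/-! ### Block diagonal matrices -/

section StackDiag

variable {ι : Type*} [DecidableEq ι] {r : ℕ}

lemma stackDiag_apply (D : ι → Matrix (Fin r) (Fin r) ℝ) (i j : ι) (a b : Fin r) :
    stackDiag D (i, a) (j, b) = if i = j then D i a b else 0 := rfl

lemma stackDiag_mulVec [Fintype ι] (D : ι → Matrix (Fin r) (Fin r) ℝ) (x : ι × Fin r → ℝ)
    (i : ι) (a : Fin r) :
    (stackDiag D *ᵥ x) (i, a) = (D i *ᵥ fun b => x (i, b)) a := by
  simp [Matrix.mulVec, dotProduct, Fintype.sum_prod_type, stackDiag_apply, ite_mul]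

lemma stackDiag_mul [Fintype ι] (C D : ι → Matrix (Fin r) (Fin r) ℝ) :
    stackDiag C * stackDiag D = stackDiag fun i => C i * D i := by
  ext ⟨i, a⟩ ⟨j, b⟩
  by_cases h : i = j <;>
  simp [Matrix.mul_apply, Fintype.sum_prod_type, stackDiag_apply, h]

lemma stackDiag_one : stackDiag (fun _ : ι => (1 : Matrix (Fin r) (Fin r) ℝ)) = 1 := by
  ext ⟨i, a⟩ ⟨j, b⟩
  simp [stackDiag_apply, Matrix.one_apply, ite_and]

lemma stackDiag_inv [Fintype ι] {D : ι → Matrix (Fin r) (Fin r) ℝ} (hD : ∀ i, IsUnit (D i).det) :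
    (stackDiag D)⁻¹ = stackDiag fun i => (D i)⁻¹ := by
  refine Matrix.inv_eq_right_inv ?_
  simp only [stackDiag_mul, Matrix.mul_nonsing_inv _ (hD _), stackDiag_one]

lemma stackDiag_posSemidef [Fintype ι] {D : ι → Matrix (Fin r) (Fin r) ℝ}
    (hD : ∀ i, (D i).PosSemidef) : (stackDiag D).PosSemidef := by
  refine .of_dotProduct_mulVec_nonneg ?_ fun x => ?_
  · ext ⟨i, a⟩ ⟨j, b⟩
    rcases eq_or_ne i j with rfl | h
    · simpa [stackDiag_apply] using (hD i).1.apply a b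
    · simp [stackDiag_apply, h, h.symm]
  · simp only [dotProduct, Fintype.sum_prod_type, stackDiag_mulVec]
    exact Finset.sum_nonneg fun i _ => (hD i).dotProduct_mulVec_nonneg fun b => x (i, b)

lemma stackDiag_posDef [Fintype ι] {D : ι → Matrix (Fin r) (Fin r) ℝ}
    (hD : ∀ i, (D i).PosDef) : (stackDiag D).PosDef := by
  refine (stackDiag_posSemidef fun i => (hD i).posSemidef).posDef_iff_isUnit.2 ?_
  refine (IsUnit.of_mul_eq_one (stackDiag fun i => (D i)⁻¹) ?_)
  have hu : ∀ i, IsUnit (D i).det := fun i => (Matrix.isUnit_iff_isUnit_det _).1 (hD i).isUnit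
  simp only [stackDiag_mul, Matrix.mul_nonsing_inv _ (hu _), stackDiag_one]

end StackDiag

/-! ### The network as a dissipative linear system -/

namespace Network

variable {V : Type*} [Fintype V] [DecidableEq V] {G : SimpleGraph V} {r : ℕ}

/-- The damping force `col(p, q) ↦ R M⁻¹ p`. -/
noncomputable def dampingForce (N : Network G r) : N.State →ₗ[ℝ] (V × Fin r → ℝ) :=
  (stackDiag N.R * (stackDiag N.M)⁻¹).mulVecLin ∘ₗ LinearMap.funLeft ℝ ℝ Sum.inl

/-- `Ω` as a linear subspace. -/
def omegaSubmodule (N : Network G r) : Submodule ℝ N.State :=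
  (LinearMap.range N.bigBᵀ.mulVecLin).comap (LinearMap.funLeft ℝ ℝ Sum.inr)

variable (N : Network G r)

lemma mem_omegaSubmodule {x : N.State} : x ∈ N.omegaSubmodule ↔ x ∈ N.Omega := by
  simp only [omegaSubmodule, Submodule.mem_comap, LinearMap.mem_range, Omega, Set.mem_ofPred_eq,
    Matrix.mulVecLin_apply, funext_iff, LinearMap.funLeft_apply]
  exact exists_congr fun s => forall_congr' fun k => eq_comm

lemma dampingForce_apply (x : N.State) (i : V) (a : Fin r) :
    N.dampingForce x (i, a) = ((N.R i * (N.M i)⁻¹) *ᵥ fun b => x (Sum.inl (i, b))) a := by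
  have hu : ∀ i, IsUnit (N.M i).det := fun i =>
    (Matrix.isUnit_iff_isUnit_det _).1 (N.M_posDef i).isUnit
  simp only [dampingForce, stackDiag_inv hu, stackDiag_mul, LinearMap.comp_apply,
    Matrix.mulVecLin_apply, stackDiag_mulVec, LinearMap.funLeft_apply]

/-- The conditions defining the LaSalle set say that the damping force vanishes. -/
lemma dampingForce_eq_zero_iff (x : N.State) : N.dampingForce x = 0 ↔
    (∀ i, N.IsDamped i → ∀ a, x (Sum.inl (i, a)) = 0) ∧
    (∀ i, N.IsUndamped i → (N.R i * (N.M i)⁻¹) *ᵥ (fun a => x (Sum.inl (i, a))) = 0) := by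
  simp only [funext_iff, Prod.forall, dampingForce_apply, Pi.zero_apply]
  constructor
  · refine fun h => ⟨fun i hi => ?_, fun i _ => h i⟩
    have hu : IsUnit (N.R i * (N.M i)⁻¹) := hi.isUnit.mul (N.M_posDef i).inv.isUnit
    refine congrFun (Matrix.mulVec_injective_of_isUnit hu ?_)
    exact (funext (h i)).trans (Matrix.mulVec_zero (N.R i * (N.M i)⁻¹)).symm
  · rintro ⟨hd, hu⟩ i
    -- A positive semidefinite matrix is singular or positive definite, so every node is of one of
    -- the two kinds.
    by_cases hi : (N.R i).det = 0
    · exact hu i hi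
    · have := hd i ((N.R_posSemidef i).posDef_iff_det_ne_zero.2 hi)
      simp [Matrix.mulVec, dotProduct, this]

variable [Fintype G.edgeSet]

/-- The vector field of the shifted system. -/
noncomputable def sysMap (N : Network G r) : N.State →L[ℝ] N.State :=
  N.sysMatrix.mulVecLin.toContinuousLinearMap

/-- The polar form of twice the Hamiltonian `½ pᵀ M⁻¹ p + ½ qᵀ W q`. -/
noncomputable def energy (N : Network G r) : N.State →L[ℝ] N.State →L[ℝ] ℝ :=
  (Matrix.toLinearMap₂' ℝ
    (Matrix.fromBlocks (stackDiag N.M)⁻¹ 0 0 (stackDiag N.W))).toContinuousBilinearMap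

lemma sysMap_apply (x : N.State) : N.sysMap x = N.sysMatrix *ᵥ x := rfl

lemma sysMatrix_mulVec (p : V × Fin r → ℝ) (q : G.edgeSet × Fin r → ℝ) :
    N.sysMatrix *ᵥ Sum.elim p q =
      Sum.elim (-(stackDiag N.R *ᵥ (stackDiag N.M)⁻¹ *ᵥ p) - N.bigB *ᵥ stackDiag N.W *ᵥ q)
        (N.bigBᵀ *ᵥ (stackDiag N.M)⁻¹ *ᵥ p) := by
  simp [sysMatrix, Matrix.fromBlocks_mulVec, Matrix.neg_mulVec, sub_eq_add_neg]

lemma energy_apply (p p' : V × Fin r → ℝ) (q q' : G.edgeSet × Fin r → ℝ) :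
    N.energy (Sum.elim p q) (Sum.elim p' q') =
      p ⬝ᵥ (stackDiag N.M)⁻¹ *ᵥ p' + q ⬝ᵥ stackDiag N.W *ᵥ q' := by
  rw [energy, LinearMap.toContinuousBilinearMap_apply, Matrix.toLinearMap₂'_apply']
  simp [Matrix.fromBlocks_mulVec, sumElim_dotProduct_sumElim]

lemma sysMap_mem_omegaSubmodule (x : N.State) : N.sysMap x ∈ N.omegaSubmodule := by
  rw [mem_omegaSubmodule, ← Sum.elim_comp_inl_inr x, sysMap_apply, sysMatrix_mulVec]
  exact ⟨_, fun k => rfl⟩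

/-- The coupling is skew: the power -(M⁻¹p)ᵀ𝔹Wq entering the nodes cancels (Wq)ᵀ𝔹ᵀM⁻¹p entering the
edges, and only damping remains. -/
lemma energy_sysMap (p : V × Fin r → ℝ) (q : G.edgeSet × Fin r → ℝ) :
    N.energy (Sum.elim p q) (N.sysMap (Sum.elim p q)) =
      -(((stackDiag N.M)⁻¹ *ᵥ p) ⬝ᵥ stackDiag N.R *ᵥ (stackDiag N.M)⁻¹ *ᵥ p) := by
  have hM : ((stackDiag N.M)⁻¹)ᵀ = (stackDiag N.M)⁻¹ := (stackDiag_posDef N.M_posDef).inv.1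
  have hW : (stackDiag N.W)ᵀ = stackDiag N.W :=
    (stackDiag_posDef N.W_posDef).1
  rw [sysMap_apply, sysMatrix_mulVec, energy_apply, Matrix.dotProduct_mulVec p,
    Matrix.dotProduct_mulVec q, ← Matrix.mulVec_transpose, ← Matrix.mulVec_transpose, hM, hW,
    dotProduct_sub, dotProduct_neg, Matrix.dotProduct_mulVec (stackDiag N.W *ᵥ q),
    Matrix.vecMul_transpose, dotProduct_comm (N.bigB *ᵥ _)]
  ring

lemma isEnergy : IsEnergy N.sysMap N.energy N.dampingForce where
  symm x y := by
    rw [← Sum.elim_comp_inl_inr x, ← Sum.elim_comp_inl_inr y, energy_apply, energy_apply]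
    have hM : ((stackDiag N.M)⁻¹)ᵀ = (stackDiag N.M)⁻¹ := (stackDiag_posDef N.M_posDef).inv.1
    have hW : (stackDiag N.W)ᵀ = stackDiag N.W :=
    (stackDiag_posDef N.W_posDef).1
    congr 1
    · rw [Matrix.dotProduct_mulVec, ← Matrix.mulVec_transpose, hM, dotProduct_comm]
    · rw [Matrix.dotProduct_mulVec, ← Matrix.mulVec_transpose, hW, dotProduct_comm]
  pos x hx := by
    rw [← Sum.elim_comp_inl_inr x, energy_apply]
    have hM := (stackDiag_posDef N.M_posDef).inv
    have hW := stackDiag_posDef N.W_posDef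
    have hp := hM.posSemidef.dotProduct_mulVec_nonneg (x ∘ Sum.inl)
    have hq := hW.posSemidef.dotProduct_mulVec_nonneg (x ∘ Sum.inr)
    by_cases h : x ∘ Sum.inl = 0
    · refine add_pos_of_nonneg_of_pos hp (hW.dotProduct_mulVec_pos fun h' => hx ?_)
      rw [← Sum.elim_comp_inl_inr x, h]
      exact (congrArg (Sum.elim (0 : V × Fin r → ℝ)) h').trans Sum.elim_zero_zero
    · exact add_pos_of_pos_of_nonneg (hM.dotProduct_mulVec_pos h) hq
  nonpos x := by
    rw [← Sum.elim_comp_inl_inr x, energy_sysMap, neg_nonpos]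
    exact (stackDiag_posSemidef N.R_posSemidef).dotProduct_mulVec_nonneg _
  eq_zero_iff x := by
    -- For semidefinite R, vᵀRv = 0 forces Rv = 0.
    have h := (stackDiag_posSemidef N.R_posSemidef).dotProduct_mulVec_zero_iff
      ((stackDiag N.M)⁻¹ *ᵥ (x ∘ Sum.inl))
    rw [star_trivial, Matrix.mulVec_mulVec _ (stackDiag N.R)] at h
    rw [← Sum.elim_comp_inl_inr x, energy_sysMap, neg_eq_zero, Matrix.mulVec_mulVec _ (stackDiag N.R)]
    exact h

lemma isSolution_linearFlow (x : N.State) : N.IsSolution fun t => linearFlow N.sysMap t x :=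
  fun t _ => (hasDerivAt_linearFlow_apply N.sysMap x t).hasDerivWithinAt

/-- Uniqueness of solutions lets the existentially quantified solution be replaced by the flow. -/
lemma laSalleSet_eq : N.laSalleSet = unobservableSet N.sysMap N.dampingForce N.omegaSubmodule := by
  ext x
  simp only [laSalleSet, unobservableSet, Set.mem_ofPred_eq, mem_omegaSubmodule,
    ← dampingForce_eq_zero_iff]
  refine and_congr_right fun _ => ⟨?_, fun h => ⟨_, N.isSolution_linearFlow x, linearFlow_zero _ x, h⟩⟩
  rintro ⟨z, hz, rfl, h⟩ t ht
  rw [← N.isEnergy.eq_linearFlow hz ht]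
  exact h t ht

end Network

theorem mainTheorem7 {V : Type*} [Fintype V] [DecidableEq V] (G : SimpleGraph V)
    [Fintype G.edgeSet] (hG : G.Connected) {r : ℕ} (N : Network G r)
    (hd : ∃ i, N.IsDamped i) (hu : ∃ i, N.IsUndamped i) :
    IsLeast {T : Set N.State | IsClosed T ∧
        ∀ z : ℝ → N.State, N.IsSolution z → (∀ t : ℝ, 0 ≤ t → z t ∈ N.Omega) →
          ConvergesToSet z T}
      N.laSalleSet := by
  rw [N.laSalleSet_eq]
  refine ⟨⟨N.isEnergy.isClosed_unobservableSet _, fun z hz hΩ ε hε => ?_⟩, fun T hT => ?_⟩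
  · have hconv := N.isEnergy.convergesToSet N.sysMap_mem_omegaSubmodule
      (N.mem_omegaSubmodule.2 (hΩ 0 le_rfl)) ε hε
    filter_upwards [hconv, eventually_ge_atTop 0] with t h ht
    rwa [N.isEnergy.eq_linearFlow hz ht]
  · refine N.isEnergy.unobservableSet_subset hT.1 fun x hx => hT.2 _ (N.isSolution_linearFlow x)
      fun t _ => N.mem_omegaSubmodule.1 ?_
    exact linearFlow_apply_mem N.sysMap_mem_omegaSubmodule hx t
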